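/- Let $k$ be an algebraically closed field of characteristic $0$, $\mathbb K=k((t))$, and $\overline{\mathbb K}$ an algebraic closure of $\mathbb K$. Fix primitive $m$-th roots of unity $\xi_m$ and $m$-th roots $t^{1/m}\in\overline{\mathbb K}$ of $t$ ($m\ge 1$) that are compatible: $\xi_{me}^{\,e}=\xi_m$ and $(t^{1/(me)})^e=t^{1/m}$ for all $m,e\ge 1$. Put $j=t^{1/2}$ and $\mathbb L=\mathbb K(j)$, let $\mathrm{Gal}(\mathbb L)=\mathrm{Gal}(\overline{\mathbb K}/\mathbb L)$, and let $\gamma_1\in\mathrm{Gal}(\overline{\mathbb K}/\mathbb K)$ be the standard generator, i.e. $\gamma_1(t^{1/m})=\xi_m t^{1/m}$ for all $m\ge 1$. Let $\mathfrak g$ be a split finite-dimensional simple Lie algebra over $\mathbb K$, let $\Omega\in\mathfrak g\otimes_{\mathbb K}\mathfrak g$ be the quadratic Casimir element of a nondegenerate symmetric invariant bilinear form on $\mathfrak g$ (for instance the Killing form), and put $\overline{\mathfrak g}=\overline{\mathbb K}\otimes_{\mathbb K}\mathfrak g$. The group $\mathrm{Gal}(\overline{\mathbb K}/\mathbb K)$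 acts on $\overline{\mathfrak g}$ through the first factor and on $\overline{\mathfrak g}\otimes_{\overline{\mathbb K}}\overline{\mathfrak g}$ by $\gamma(r)=(\gamma\otimes\gamma)(r)$; $r^{21}$ denotes the image of $r$ under $a\otimes b\mapsto b\otimes a$. Let $r\in\overline{\mathfrak g}\otimes_{\overline{\mathbb K}}\overline{\mathfrak g}$ be an $r$-matrix, that is, $[r^{12},r^{13}]+[r^{12},r^{23}]+[r^{13},r^{23}]=0$. Suppose that $r$ defines a Lie bialgebra structure on $\mathfrak g$, i.e. $\delta(a)=[a\otimes 1+1\otimes a,\,r]$ maps $\mathfrak g$ into $\mathfrak g\otimes_{\mathbb K}\mathfrak g$ and is there a Lie bialgebra cobracket, and that $r+r^{21}=j\Omega$. Then (a) $\gamma(r)=r$ for all $\gamma\in\mathrm{Gal}(\mathbb L)$; (b) $\gamma_1(r)=-r^{21}$. -/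

import Mathlib

open scoped TensorProduct

noncomputable section

namespace LieBialg

section General

variable {R L : Type*} [CommRing R] [LieRing L] [LieAlgebra R L]

/-- The linear map `L ⊗ L → L`, `x ⊗ y ↦ ⁅x, y⁆`. -/
def bracketMap (R L : Type*) [CommRing R] [LieRing L] [LieAlgebra R L] : L ⊗[R] L →ₗ[R] L :=
  (LieModule.toModuleHom R L L : L ⊗[R] L →ₗ[R] L)

/-- The flip `a ⊗ b ↦ b ⊗ a`, so that `flip21 r` is `r²¹`. -/
def flip21 (r : L ⊗[R] L) : L ⊗[R] L := TensorProduct.comm R L L r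

/-- `⁅r¹², s¹³⁆`: `(a ⊗ b) ⊗ (c ⊗ d) ↦ ⁅a, c⁆ ⊗ (b ⊗ d)`. -/
def bracket1213 (R L : Type*) [CommRing R] [LieRing L] [LieAlgebra R L] :
    (L ⊗[R] L) ⊗[R] (L ⊗[R] L) →ₗ[R] L ⊗[R] (L ⊗[R] L) :=
  (bracketMap R L).rTensor (L ⊗[R] L) ∘ₗ
    (TensorProduct.tensorTensorTensorComm R L L L L).toLinearMap

/-- `⁅r¹², s²³⁆`: `(a ⊗ b) ⊗ (c ⊗ d) ↦ a ⊗ (⁅b, c⁆ ⊗ d)`. -/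
def bracket1223 (R L : Type*) [CommRing R] [LieRing L] [LieAlgebra R L] :
    (L ⊗[R] L) ⊗[R] (L ⊗[R] L) →ₗ[R] L ⊗[R] (L ⊗[R] L) :=
  ((bracketMap R L).rTensor L ∘ₗ (TensorProduct.assoc R L L L).symm.toLinearMap).lTensor L ∘ₗ
    (TensorProduct.assoc R L L (L ⊗[R] L)).toLinearMap

/-- `⁅r¹³, s²³⁆`: `(a ⊗ b) ⊗ (c ⊗ d) ↦ a ⊗ (c ⊗ ⁅b, d⁆)`. -/
def bracket1323 (R L : Type*) [CommRing R] [LieRing L] [LieAlgebra R L] :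
    (L ⊗[R] L) ⊗[R] (L ⊗[R] L) →ₗ[R] L ⊗[R] (L ⊗[R] L) :=
  (TensorProduct.assoc R L L L).toLinearMap ∘ₗ (bracketMap R L).lTensor (L ⊗[R] L) ∘ₗ
    (TensorProduct.tensorTensorTensorComm R L L L L).toLinearMap

/-- `CYB(r) = ⁅r¹², r¹³⁆ + ⁅r¹², r²³⁆ + ⁅r¹³, r²³⁆`, an element of `L ⊗ L ⊗ L`. -/
def CYB (r : L ⊗[R] L) : L ⊗[R] (L ⊗[R] L) :=
  bracket1213 R L (r ⊗ₜ[R] r) + bracket1223 R L (r ⊗ₜ[R] r) + bracket1323 R L (r ⊗ₜ[R] r)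

/-- An `r`-matrix: a solution of the classical Yang–Baxter equation. -/
def IsRMatrix (r : L ⊗[R] L) : Prop := CYB r = 0

/-- The cyclic permutation `a ⊗ (b ⊗ c) ↦ b ⊗ (c ⊗ a)`. -/
def cyclicPerm (R L : Type*) [CommRing R] [LieRing L] [LieAlgebra R L] :
    L ⊗[R] (L ⊗[R] L) →ₗ[R] L ⊗[R] (L ⊗[R] L) :=
  (TensorProduct.assoc R L L L).toLinearMap ∘ₗ (TensorProduct.comm R L (L ⊗[R] L)).toLinearMap

/-- `δ` is the cobracket of a Lie bialgebra structure on the Lie algebra `L`: it is skew-symmetric,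
satisfies the co-Jacobi identity, and is a 1-cocycle with values in `L ⊗ L`, on which `L` acts
by `⁅a, b ⊗ c⁆ = ⁅a, b⁆ ⊗ c + b ⊗ ⁅a, c⁆`. -/
structure IsLieBialgebra (δ : L →ₗ[R] L ⊗[R] L) : Prop where
  skew : ∀ a : L, flip21 (δ a) = -δ a
  coJacobi : ∀ a : L,
    δ.lTensor L (δ a) + cyclicPerm R L (δ.lTensor L (δ a)) +
      cyclicPerm R L (cyclicPerm R L (δ.lTensor L (δ a))) = 0
  cocycle : ∀ a b : L, δ ⁅a, b⁆ = ⁅a, δ b⁆ - ⁅b, δ a⁆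

end General

section OverField

variable (K : Type*) [Field K] (g : Type*) [LieRing g] [LieAlgebra K g]

/-- A Lie algebra is split if it has a Cartan subalgebra all of whose elements act
triangularizably on it. -/
def IsSplit : Prop :=
  ∃ H : LieSubalgebra K g, H.IsCartanSubalgebra ∧ LieModule.IsTriangularizable K H g

variable {K g}

/-- The quadratic Casimir element `∑ eⁱ ⊗ eᵢ ∈ g ⊗ g` of a nondegenerate bilinear form `B`,
where `(eᵢ)` is a basis of `g` and `(eⁱ)` the `B`-dual basis. It does not depend on the basis,
see `casimir_eq_sum`. -/
def casimir [FiniteDimensional K g] (B : LinearMap.BilinForm K g) (hB : B.Nondegenerate) :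
    g ⊗[K] g :=
  ∑ i, B.dualBasis hB (Module.finBasis K g) i ⊗ₜ[K] Module.finBasis K g i

theorem casimir_eq_sum [FiniteDimensional K g] (B : LinearMap.BilinForm K g)
    (hB : B.Nondegenerate) {ι : Type*} [Fintype ι] [DecidableEq ι] (b : Module.Basis ι K g) :
    casimir B hB = ∑ i, B.dualBasis hB b i ⊗ₜ[K] b i := by
  set c := Module.finBasis K g
  have hdual : ∀ i, ∑ l, c.repr (b l) i • B.dualBasis hB b l = B.dualBasis hB c i := by
    intro i
    apply (B.toDual hB).injective
    simpa [LinearMap.BilinForm.dualBasis] using b.sum_dual_apply_smul_coord (c.coord i)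
  have hb : ∀ l, B.dualBasis hB b l ⊗ₜ[K] b l
      = ∑ i, (c.repr (b l) i • B.dualBasis hB b l) ⊗ₜ[K] c i := by
    intro l
    conv_lhs => rw [← c.sum_repr (b l)]
    rw [TensorProduct.tmul_sum]
    exact Finset.sum_congr rfl fun i _ => (TensorProduct.smul_tmul _ _ _).symm
  simp_rw [hb]
  rw [Finset.sum_comm]
  simp_rw [← TensorProduct.sum_tmul, hdual]
  rfl

end OverField

section BaseChange

variable {K F g : Type*} [Field K] [Field F] [Algebra K F] [LieRing g] [LieAlgebra K g]

/-- The natural map `g ⊗_K g → (F ⊗ g) ⊗_F (F ⊗ g)`. -/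
def baseChangeMap (K F g : Type*) [Field K] [Field F] [Algebra K F] [LieRing g] [LieAlgebra K g] :
    g ⊗[K] g →ₗ[K] (F ⊗[K] g) ⊗[F] (F ⊗[K] g) :=
  ((TensorProduct.AlgebraTensorModule.distribBaseChange K F g g).toLinearMap.restrictScalars K) ∘ₗ
    TensorProduct.mk K F (g ⊗[K] g) 1

theorem baseChangeMap_tmul (x y : g) :
    baseChangeMap K F g (x ⊗ₜ[K] y) = (1 ⊗ₜ[K] x) ⊗ₜ[F] (1 ⊗ₜ[K] y) := by
  simp [baseChangeMap]

/-- `r ∈ (F ⊗ g) ⊗_F (F ⊗ g)` defines a Lie bialgebra structure on `g`: the coboundary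
`a ↦ [a ⊗ 1 + 1 ⊗ a, r]` carries `g` into `g ⊗_K g` and is there the cobracket of a
Lie bialgebra structure. -/
def DefinesLieBialgebra (r : (F ⊗[K] g) ⊗[F] (F ⊗[K] g)) : Prop :=
  ∃ δ : g →ₗ[K] g ⊗[K] g, IsLieBialgebra δ ∧
    ∀ a : g, baseChangeMap K F g (δ a) = ⁅(1 : F) ⊗ₜ[K] a, r⁆

/-- The `γ`-semilinear action of `γ ∈ Gal(F/K)` on `F ⊗ g`, `c ⊗ x ↦ γ(c) ⊗ x`. -/
def galoisMap (g : Type*) [LieRing g] [LieAlgebra K g] (γ : F ≃ₐ[K] F) :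
    F ⊗[K] g →ₛₗ[(γ : F →+* F)] F ⊗[K] g where
  toFun := γ.toLinearMap.rTensor g
  map_add' := map_add _
  map_smul' c x := by
    induction x with
    | zero => simp
    | tmul a y => simp [TensorProduct.smul_tmul']
    | add x y hx hy => simp [smul_add, hx, hy]

/-- The action `γ(r) = (γ ⊗ γ)(r)` of `Gal(F/K)` on `(F ⊗ g) ⊗_F (F ⊗ g)`. -/
def galoisAct (γ : F ≃ₐ[K] F) (r : (F ⊗[K] g) ⊗[F] (F ⊗[K] g)) :
    (F ⊗[K] g) ⊗[F] (F ⊗[K] g) :=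
  TensorProduct.map (galoisMap g γ) (galoisMap g γ) r

end BaseChange

section Roots

variable {F : Type*} [Field F]

/-- A compatible system of primitive `m`-th roots of unity, `m ≥ 1`. -/
structure IsCompatiblePrimitiveRoots (ξ : ℕ → F) : Prop where
  primitive : ∀ m, 0 < m → IsPrimitiveRoot (ξ m) m
  compatible : ∀ m e, 0 < m → 0 < e → ξ (m * e) ^ e = ξ m

/-- A compatible system of `m`-th roots `s m = t^{1/m}` of `t`, `m ≥ 1`. -/
structure IsCompatibleRoots (t : F) (s : ℕ → F) : Prop where
  pow_eq : ∀ m, 0 < m → s m ^ m = t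
  compatible : ∀ m e, 0 < m → 0 < e → s (m * e) ^ e = s m

/-- `γ` is the standard generator of the Galois group attached to the roots of unity `ξ m`
and the roots `s m = t^{1/m}`: it sends `t^{1/m}` to `ξ_m t^{1/m}` for all `m ≥ 1`. -/
def IsStandardGenerator {K : Type*} [Field K] [Algebra K F] (ξ s : ℕ → F) (γ : F ≃ₐ[K] F) : Prop :=
  ∀ m, 0 < m → γ (s m) = ξ m * s m

end Roots

end LieBialg

end

open scoped TensorProduct

/-! The cobracket `δ` is defined over `K`, so `γ(r)` induces the same coboundary on `g` as `r`,
while its symmetrization is `γ(j)Ω`. Hence `γ(r) - r` when `γ(j) = j`, and `γ₁(r) + r²¹` since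
`γ₁(j) = -j`, are skew and `g`-invariant. Such tensors vanish (`eq_zero_of_skew_of_invariant`):
contracting with the invariant form gives a skew invariant `K`-bilinear map on `g` with values in
`F`, which is zero because `g` is perfect. Simplicity is thus needed only over `K`, not for `F ⊗ g`.
-/

namespace LieBialg

/-! ### Skew invariant bilinear maps on a simple Lie algebra -/

section Invariants

/-- A linear map on a simple Lie algebra which vanishes on brackets is zero. -/
theorem linearMap_eq_zero_of_lie_eq_zero {K g : Type*} [CommRing K] [LieRing g] [LieAlgebra K g]
    [LieAlgebra.IsSimple K g] {M : Type*} [AddCommGroup M] [Module K M] (φ : g →ₗ[K] M)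
    (h : ∀ x y : g, φ ⁅x, y⁆ = 0) : φ = 0 := by
  -- Simple implies perfect: the derived ideal is nonzero because `g` is not abelian.
  have htop : (⁅(⊤ : LieIdeal K g), (⊤ : LieIdeal K g)⁆ : LieIdeal K g) = ⊤ := by
    rcases LieAlgebra.IsSimple.eq_bot_or_eq_top (R := K)
      (⁅(⊤ : LieIdeal K g), (⊤ : LieIdeal K g)⁆) with hb | ht
    · refine absurd ⟨fun x y => ?_⟩ (LieAlgebra.IsSimple.non_abelian K (L := g))
      have h : ⁅x, y⁆ ∈ (⁅(⊤ : LieIdeal K g), (⊤ : LieIdeal K g)⁆ : LieIdeal K g) :=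
        LieSubmodule.lie_mem_lie (LieSubmodule.mem_top x) (LieSubmodule.mem_top y)
      rwa [hb, LieSubmodule.mem_bot] at h
    · exact ht
  have hspan : Submodule.span K {m : g | ∃ x y : g, ⁅x, y⁆ = m} = ⊤ := by
    have := congrArg LieSubmodule.toSubmodule htop
    rw [LieSubmodule.lieIdeal_oper_eq_linear_span'] at this
    simpa using this
  refine LinearMap.ext_on hspan ?_
  rintro _ ⟨x, y, rfl⟩
  simpa using h x y

/-- A skew-symmetric invariant bilinear map on a simple Lie algebra vanishes. -/
theorem skew_invariant_eq_zero {K g M : Type*} [CommRing K] [LieRing g] [LieAlgebra K g]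
    [LieAlgebra.IsSimple K g] [AddCommGroup M] [Module K M] [IsAddTorsionFree M]
    (β : g →ₗ[K] g →ₗ[K] M) (hskew : ∀ x y, β x y = -β y x)
    (hinv : ∀ x y z : g, β ⁅x, y⁆ z = -β y ⁅x, z⁆) : β = 0 := by
  have hsymm : ∀ x y z : g, β ⁅x, y⁆ z = β ⁅x, z⁆ y := fun x y z => by
    rw [hinv, hskew, neg_neg]
  have hanti : ∀ x y z : g, β ⁅x, y⁆ z = -β ⁅y, x⁆ z := fun x y z => by
    rw [← lie_skew, map_neg, LinearMap.neg_apply]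
  -- `β ⁅x, y⁆ z` is antisymmetric in `x, y` and symmetric in `y, z`, so each cyclic rotation of the
  -- arguments changes its sign; three rotations make it its own negative.
  refine linearMap_eq_zero_of_lie_eq_zero β fun x y => LinearMap.ext fun z => self_eq_neg.1 ?_
  calc β ⁅x, y⁆ z = -β ⁅z, x⁆ y := by rw [hsymm, hanti]
    _ = β ⁅y, z⁆ x := by rw [hsymm, hanti, neg_neg]
    _ = -β ⁅x, y⁆ z := by rw [hsymm, hanti]

end Invariants

/-! ### Contraction of tensors over `F` against the form -/

section BaseChange

variable {K F g : Type*} [Field K] [Field F] [Algebra K F] [LieRing g] [LieAlgebra K g]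

variable (F) in
/-- The `F`-linear functional `c ⊗ y ↦ c B(x, y)` on `F ⊗ g`. -/
def formFunctional (B : LinearMap.BilinForm K g) :
    g →ₗ[K] (F ⊗[K] g →ₗ[F] F) where
  toFun x := (TensorProduct.AlgebraTensorModule.rid K F F).toLinearMap ∘ₗ (B x).baseChange F
  map_add' x y := by
    ext z
    simp
  map_smul' c x := by
    ext z
    simp [TensorProduct.smul_tmul', Algebra.smul_def, mul_comm]

@[simp]
theorem formFunctional_tmul (B : LinearMap.BilinForm K g) (x y : g) (c : F) :
    formFunctional F B x (c ⊗ₜ y) = B x y • c := by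
  simp [formFunctional]

theorem formFunctional_lie {B : LinearMap.BilinForm K g} (hB : B.lieInvariant g) (a x : g)
    (w : F ⊗[K] g) :
    formFunctional F B ⁅a, x⁆ w = -formFunctional F B x ⁅(1 : F) ⊗ₜ[K] a, w⁆ := by
  induction w with
  | zero => simp
  | tmul c y => simp [hB a x y]
  | add u v hu hv => simp only [map_add, lie_add, hu, hv, neg_add]

/-- The bilinear map `(x, y) ↦ (B(x, ·) ⊗ B(y, ·))(ν)`. -/
def contraction (B : LinearMap.BilinForm K g) (ν : (F ⊗[K] g) ⊗[F] (F ⊗[K] g)) :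
    g →ₗ[K] g →ₗ[K] F :=
  LinearMap.mk₂ K (fun x y => LinearMap.mul' F F
      (TensorProduct.map (formFunctional F B x) (formFunctional F B y) ν))
    (fun _ _ _ => by simp [TensorProduct.map_add_left])
    (fun c x y => by
      induction ν with
      | zero => simp
      | tmul u v => simp
      | add u v hu hv => simp only [map_add, hu, hv, smul_add])
    (fun _ _ _ => by simp [TensorProduct.map_add_right])
    (fun c x y => by
      induction ν with
      | zero => simp
      | tmul u v => simp
      | add u v hu hv => simp only [map_add, hu, hv, smul_add])

theorem contraction_apply (B : LinearMap.BilinForm K g) (ν : (F ⊗[K] g) ⊗[F] (F ⊗[K] g))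
    (x y : g) : contraction B ν x y = LinearMap.mul' F F
      (TensorProduct.map (formFunctional F B x) (formFunctional F B y) ν) := rfl

theorem contraction_flip21 (B : LinearMap.BilinForm K g) (ν : (F ⊗[K] g) ⊗[F] (F ⊗[K] g))
    (x y : g) : contraction B (flip21 ν) x y = contraction B ν y x := by
  simp only [contraction_apply, flip21]
  induction ν with
  | zero => simp
  | tmul u v => simp [mul_comm]
  | add u v hu hv => simp only [map_add, hu, hv]

/-- Invariance of `B` moves the action of `a` from `ν` to the arguments, so an invariant tensor
contracts to an invariant form. -/
theorem contraction_lie {B : LinearMap.BilinForm K g} (hB : B.lieInvariant g)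
    (ν : (F ⊗[K] g) ⊗[F] (F ⊗[K] g)) (a x y : g) :
    contraction B ⁅(1 : F) ⊗ₜ[K] a, ν⁆ x y =
      -contraction B ν ⁅a, x⁆ y - contraction B ν x ⁅a, y⁆ := by
  simp only [contraction_apply]
  induction ν with
  | zero => simp
  | tmul u v => simp [TensorProduct.LieModule.lie_tmul_right, formFunctional_lie hB]
  | add u v hu hv =>
    simp only [map_add, lie_add, hu, hv]
    ring

/-- On the `B`-dual basis the functionals become the coordinates of the base-changed basis, so the
contraction records every coordinate of `ν`. -/
theorem eq_zero_of_contraction_eq_zero [FiniteDimensional K g] {B : LinearMap.BilinForm K g}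
    (hB : B.Nondegenerate) {ν : (F ⊗[K] g) ⊗[F] (F ⊗[K] g)} (h : contraction B ν = 0) :
    ν = 0 := by
  classical
  let b := Module.finBasis K g
  let c := b.baseChange F
  have hc : ∀ i, formFunctional F B (B.dualBasis hB b i) = c.coord i := fun i =>
    c.ext fun l => by
      simp [c, LinearMap.BilinForm.apply_dualBasis_left, Module.Basis.baseChange_apply,
        Finsupp.single_apply, eq_comm]
  refine (c.tensorProduct c).ext_elem fun p => ?_
  have hp := LinearMap.congr_fun₂ h (B.dualBasis hB b p.1) (B.dualBasis hB b p.2)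
  rw [contraction_apply, hc, hc] at hp
  simp only [LinearMap.zero_apply] at hp
  rw [map_zero, Finsupp.zero_apply, ← hp]
  clear hp h
  induction ν with
  | zero => simp
  | tmul u v => simp [c.tensorProduct_repr_tmul_apply c u v p.1 p.2, mul_comm]
  | add u v hu hv => simp only [map_add, Finsupp.add_apply, hu, hv]

/-- `(Λ² (F ⊗ g))^g = 0` for a simple Lie algebra `g` with a nondegenerate invariant form. -/
theorem eq_zero_of_skew_of_invariant [CharZero F] [FiniteDimensional K g]
    [LieAlgebra.IsSimple K g] {B : LinearMap.BilinForm K g} (hB : B.Nondegenerate)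
    (hBinv : B.lieInvariant g) {ν : (F ⊗[K] g) ⊗[F] (F ⊗[K] g)} (hskew : ν + flip21 ν = 0)
    (hinv : ∀ a : g, ⁅(1 : F) ⊗ₜ[K] a, ν⁆ = 0) : ν = 0 := by
  refine eq_zero_of_contraction_eq_zero hB (skew_invariant_eq_zero _ (fun x y => ?_) ?_)
  · rw [← contraction_flip21, eq_neg_of_add_eq_zero_right hskew]
    simp [contraction_apply]
  · intro a x y
    have h := contraction_lie hBinv ν a x y
    rw [hinv, contraction_apply, map_zero, map_zero] at h
    linear_combination h

theorem lie_flip21 {R L : Type*} [CommRing R] [LieRing L] [LieAlgebra R L] (a : L) (r : L ⊗[R] L) :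
    ⁅a, flip21 r⁆ = flip21 ⁅a, r⁆ := by
  simp only [flip21]
  induction r with
  | zero => simp
  | tmul u v => simp [TensorProduct.LieModule.lie_tmul_right, add_comm]
  | add u v hu hv => simp only [map_add, lie_add, hu, hv]

theorem flip21_baseChangeMap (x : g ⊗[K] g) :
    flip21 (baseChangeMap K F g x) = baseChangeMap K F g (flip21 x) := by
  simp only [flip21]
  induction x with
  | zero => simp
  | tmul u v => simp [baseChangeMap_tmul]
  | add u v hu hv => simp only [map_add, hu, hv]

/-! ### Compatibility of the Galois action -/

@[simp]
theorem galoisMap_tmul (γ : F ≃ₐ[K] F) (c : F) (x : g) :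
    galoisMap g γ (c ⊗ₜ[K] x) = γ c ⊗ₜ[K] x := rfl

theorem galoisAct_add (γ : F ≃ₐ[K] F) (r s : (F ⊗[K] g) ⊗[F] (F ⊗[K] g)) :
    galoisAct γ (r + s) = galoisAct γ r + galoisAct γ s :=
  map_add _ _ _

theorem galoisAct_smul (γ : F ≃ₐ[K] F) (c : F) (r : (F ⊗[K] g) ⊗[F] (F ⊗[K] g)) :
    galoisAct γ (c • r) = γ c • galoisAct γ r :=
  LinearMap.map_smulₛₗ _ _ _

theorem galoisAct_baseChangeMap (γ : F ≃ₐ[K] F) (x : g ⊗[K] g) :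
    galoisAct γ (baseChangeMap K F g x) = baseChangeMap K F g x := by
  simp only [galoisAct]
  induction x with
  | zero => simp
  | tmul u v => simp [baseChangeMap_tmul]
  | add u v hu hv => simp only [map_add, hu, hv]

theorem galoisAct_flip21 (γ : F ≃ₐ[K] F) (r : (F ⊗[K] g) ⊗[F] (F ⊗[K] g)) :
    galoisAct γ (flip21 r) = flip21 (galoisAct γ r) := by
  simp only [galoisAct, flip21]
  induction r with
  | zero => simp
  | tmul u v => simp
  | add u v hu hv => simp only [map_add, hu, hv]

theorem galoisMap_lie (γ : F ≃ₐ[K] F) (a : g) (x : F ⊗[K] g) :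
    galoisMap g γ ⁅(1 : F) ⊗ₜ[K] a, x⁆ = ⁅(1 : F) ⊗ₜ[K] a, galoisMap g γ x⁆ := by
  induction x with
  | zero => simp
  | tmul c y => simp
  | add u v hu hv => simp only [map_add, lie_add, hu, hv]

theorem galoisAct_lie (γ : F ≃ₐ[K] F) (a : g) (r : (F ⊗[K] g) ⊗[F] (F ⊗[K] g)) :
    galoisAct γ ⁅(1 : F) ⊗ₜ[K] a, r⁆ = ⁅(1 : F) ⊗ₜ[K] a, galoisAct γ r⁆ := by
  simp only [galoisAct]
  induction r with
  | zero => simp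
  | tmul u v => simp [TensorProduct.LieModule.lie_tmul_right, galoisMap_lie]
  | add u v hu hv => simp only [map_add, lie_add, hu, hv]

end BaseChange

end LieBialg

theorem mainTheorem11
    {k : Type*} [Field k] [IsAlgClosed k] [CharZero k]
    {F : Type*} [Field F] [Algebra (LaurentSeries k) F] [IsAlgClosure (LaurentSeries k) F]
    {g : Type*} [LieRing g] [LieAlgebra (LaurentSeries k) g]
    [FiniteDimensional (LaurentSeries k) g]
    [LieAlgebra.IsSimple (LaurentSeries k) g] (hsplit : LieBialg.IsSplit (LaurentSeries k) g)
    (B : LinearMap.BilinForm (LaurentSeries k) g) (hB : B.Nondegenerate) (hBsymm : B.IsSymm)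
    (hBinv : B.lieInvariant g)
    (ξ s : ℕ → F) (hξ : LieBialg.IsCompatiblePrimitiveRoots ξ)
    (hs : LieBialg.IsCompatibleRoots
      (algebraMap (LaurentSeries k) F (HahnSeries.single (1 : ℤ) (1 : k))) s)
    (j : F) (hj : s 2 = j)
    (γ₁ : F ≃ₐ[LaurentSeries k] F) (hγ₁ : LieBialg.IsStandardGenerator ξ s γ₁)
    (r : (F ⊗[LaurentSeries k] g) ⊗[F] (F ⊗[LaurentSeries k] g))
    (hr : LieBialg.IsRMatrix r) (hδ : LieBialg.DefinesLieBialgebra r)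
    (hΩ : r + LieBialg.flip21 r = j • LieBialg.baseChangeMap (LaurentSeries k) F g (LieBialg.casimir B hB)) :
    (∀ γ ∈ (IntermediateField.adjoin (LaurentSeries k) {j}).fixingSubgroup, LieBialg.galoisAct γ r = r) ∧
      LieBialg.galoisAct γ₁ r = -LieBialg.flip21 r := by
  obtain ⟨δ, hδ, hδr⟩ := hδ
  have : CharZero (LaurentSeries k) := charZero_of_injective_algebraMap
    (algebraMap k (LaurentSeries k)).injective
  have : CharZero F := charZero_of_injective_algebraMap
    (algebraMap (LaurentSeries k) F).injective
  have hsum : ∀ γ : F ≃ₐ[LaurentSeries k] F,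
      LieBialg.galoisAct γ r + LieBialg.flip21 (LieBialg.galoisAct γ r) =
        γ j • LieBialg.baseChangeMap (LaurentSeries k) F g (LieBialg.casimir B hB) := fun γ => by
    rw [← LieBialg.galoisAct_flip21, ← LieBialg.galoisAct_add, hΩ, LieBialg.galoisAct_smul,
      LieBialg.galoisAct_baseChangeMap]
  -- Both `1 ⊗ a` and the image of `δ a` are Galois-fixed.
  have hlie : ∀ (γ : F ≃ₐ[LaurentSeries k] F) (a : g),
      ⁅(1 : F) ⊗ₜ[LaurentSeries k] a, LieBialg.galoisAct γ r⁆ =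
        LieBialg.baseChangeMap (LaurentSeries k) F g (δ a) := fun γ a => by
    rw [← LieBialg.galoisAct_lie, ← hδr, LieBialg.galoisAct_baseChangeMap]
  constructor
  · intro γ hγ
    have hγj : γ j = j := (IntermediateField.mem_fixingSubgroup_iff _ _).1 hγ j
      (IntermediateField.mem_adjoin_simple_self _ j)
    refine sub_eq_zero.1 (LieBialg.eq_zero_of_skew_of_invariant hB hBinv ?_ fun a => ?_)
    · have h := (hsum γ).trans ((congrArg (· • _) hγj).trans hΩ.symm)
      simp only [LieBialg.flip21, map_sub] at h ⊢
      rw [sub_add_sub_comm, h, sub_self]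
    · rw [lie_sub, hlie, ← hδr, sub_self]
  · have hξ₂ : ξ 2 = -1 := (hξ.primitive 2 two_pos).eq_neg_one_of_two_right
    have hγj : γ₁ j = -j := by rw [← hj, hγ₁ 2 two_pos, hξ₂, neg_one_mul]
    refine eq_neg_of_add_eq_zero_left
      (LieBialg.eq_zero_of_skew_of_invariant hB hBinv ?_ fun a => ?_)
    -- The symmetrizations of `γ₁(r)` and `r²¹` are `-jΩ` and `jΩ`, which cancel.
    · have h := congrArg₂ (· + ·) (hsum γ₁) hΩ
      simp only [← add_smul, hγj, neg_add_cancel, zero_smul] at h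
      simp only [LieBialg.flip21, map_add, TensorProduct.comm_comm] at h ⊢
      rw [add_add_add_comm, add_comm (TensorProduct.comm _ _ _ r), h]
    -- By skew-symmetry of `δ`, the coboundary of `r²¹` is `-δ`.
    · rw [lie_add, hlie, LieBialg.lie_flip21, ← hδr, LieBialg.flip21_baseChangeMap, hδ.skew,
        map_neg, add_neg_cancel]
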